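/- Let $d\ge 1$ be a square-free integer, let $\xi=\frac{1+\sqrt{-d}}{2}$ if $-d\equiv 1 \pmod 4$ and $\xi=\sqrt{-d}$ otherwise, so that $\mathbb{Z}[\xi]$ is the ring of integers of $\mathbb{Q}(\sqrt{-d})$. Let $\rho=\max_{x\in\mathbb{C}}\min_{q\in\mathbb{Z}[\xi]}|x-q|$ be its covering radius, and let $\delta$ satisfy $\rho^2<\delta\le 1$. (Such a $\delta$ exists only if $d\in\{1,2,3,7,11\}$.) Let $n\ge 1$. For $\mathbf{h}\in\mathbb{C}^n$, $P>0$ let $\mathbf{I}_n+P\mathbf{h}\mathbf{h}^\dagger=\mathbf{L}\mathbf{D}\mathbf{L}^\dagger$ be the LDL decomposition ($\mathbf{L}$ lower triangular with unit diagonal, $\mathbf{D}$ diagonal with positive entries) and let $\mathbf{B}=\mathbf{D}^{-1/2}\mathbf{L}^{-1}$ be the basis of the compute-and-forward lattice, so that $\|\mathbf{B}\mathbf{a}\|^2=\mathbf{a}^\dagger(\mathbf{I}_n+P\mathbf{h}\mathbf{h}^\dagger)^{-1}\mathbf{a}$. A basis $\tilde{\mathbf{B}}=\mathbf{B}\mathbf{U}$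 of this $\mathbb{Z}[\xi]$-lattice, with $\mathbf{U}\in\mathrm{GL}_n(\mathbb{Z}[\xi])$, is called ALLL-reduced (with Lovász parameter $\delta$) if it has a QR decomposition $\tilde{\mathbf{B}}=\mathbf{Q}\mathbf{R}$ ($\mathbf{Q}$ unitary, $\mathbf{R}$ upper triangular) such that $0$ is a nearest element of $\mathbb{Z}[\xi]$ to $R_{j,k}/R_{j,j}$ for all $j<k$, and $\delta|R_{j-1,j-1}|^2\le|R_{j,j}|^2+|R_{j-1,j}|^2$ for $2\le j\le n$. For such a reduced basis let $\mathbf{a}^*\in\mathbb{Z}[\xi]^n$ be the first column of $\mathbf{U}$, i.e. the coefficient vector of the first reduced basis vector, $\tilde{\mathbf{b}}_1=\mathbf{B}\mathbf{a}^*$. Let $$\mathcal{R}_{\mathrm{comp}}(\mathbf{h},\mathbf{a},P)=\log^+\!\Big(\frac{1}{\mathbf{a}^\dagger(\mathbf{I}_n+P\mathbf{h}\mathbf{h}^\dagger)^{-1}\mathbf{a}}\Big),\qquad \log^+(x)=\max(\log x,0).$$ Then for almost every $\mathbf{h}\in\mathbb{C}^n$ (with respect to Lebesgue measure) the following holds.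 For every $P>0$ an ALLL-reduced basis, and hence a vector $\mathbf{a}^*$, exists; and for every choice $P\mapsto\mathbf{a}^*=\mathbf{a}^*(P)$ of such vectors, the computation-rate degrees of freedom exist and equal $$d_{\mathrm{comp}}(\mathbf{h},\mathbf{a}^*)=\lim_{P\to\infty}\frac{\mathcal{R}_{\mathrm{comp}}(\mathbf{h},\mathbf{a}^*(P),P)}{\log(1+P)}=\frac1n .$$ -/

import Mathlib

open Filter Topology MeasureTheory
open scoped Matrix

noncomputable section

namespace AlgLLL

/-- The generator `ξ` of the ring of integers of `ℚ(√-d)` for square-free `d > 0`: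
`(1 + √-d)/2` if `-d ≡ 1 (mod 4)`, and `√-d` otherwise. -/
def xi (d : ℕ) : ℂ :=
  if d % 4 = 3 then (1 + (Real.sqrt d : ℂ) * Complex.I) / 2 else (Real.sqrt d : ℂ) * Complex.I

/-- The ring `ℤ[ξ]`, as a subring of `ℂ`. -/
abbrev Zxi (d : ℕ) : Subalgebra ℤ ℂ := Algebra.adjoin ℤ {xi d}

/-- The covering radius of `ℤ[ξ]` in `ℂ`: the largest distance of a complex number to its nearest
element of `ℤ[ξ]`. -/
def coveringRadius (d : ℕ) : ℝ := ⨆ x : ℂ, Metric.infDist x (Zxi d : Set ℂ)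

/-- `0` is a nearest element of `ℤ[ξ]` to `x`, i.e. the quantisation of `x` is `0`. -/
def FullyReduced (d : ℕ) (x : ℂ) : Prop := ∀ q ∈ Zxi d, ‖x‖ ≤ ‖x - q‖

/-- `B` is ALLL-reduced over `ℤ[ξ]` with Lovász parameter `δ`: its QR-decomposition satisfies the
size reduction condition and Lovász's condition. -/
def IsALLLReduced (d : ℕ) (δ : ℝ) {n : ℕ} (B : Matrix (Fin n) (Fin n) ℂ) : Prop :=
  ∃ Q R : Matrix (Fin n) (Fin n) ℂ,
    Q ∈ Matrix.unitaryGroup (Fin n) ℂ ∧ (∀ i j, j < i → R i j = 0) ∧ B = Q * R ∧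
    (∀ j k, j < k → FullyReduced d (R j k / R j j)) ∧
    (∀ i j : Fin n, (i : ℕ) + 1 = j → δ * ‖R i i‖ ^ 2 ≤ ‖R j j‖ ^ 2 + ‖R i j‖ ^ 2)

/-- The matrix `I + P h h†`. -/
def channelMatrix {n : ℕ} (h : Fin n → ℂ) (P : ℝ) : Matrix (Fin n) (Fin n) ℂ :=
  1 + (P : ℂ) • Matrix.vecMulVec h (star h)

/-- `M = L D L†` is the LDL decomposition of `M`: `L` is lower triangular with unit diagonal and
`D` is the diagonal matrix with the positive diagonal entries `D i`. -/
def IsLDL {n : ℕ} (M L : Matrix (Fin n) (Fin n) ℂ) (D : Fin n → ℝ) : Prop :=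
  (∀ i j, i < j → L i j = 0) ∧ (∀ i, L i i = 1) ∧ (∀ i, 0 < D i) ∧
    M = L * Matrix.diagonal (fun i => (D i : ℂ)) * Lᴴ

/-- The basis `D^{-1/2} L⁻¹` of the compute-and-forward lattice; its Gram matrix is
`(L D L†)⁻¹`. -/
def cfBasis {n : ℕ} (L : Matrix (Fin n) (Fin n) ℂ) (D : Fin n → ℝ) : Matrix (Fin n) (Fin n) ℂ :=
  Matrix.diagonal (fun i => (((Real.sqrt (D i))⁻¹ : ℝ) : ℂ)) * L⁻¹

/-- `a` is the coefficient vector of the first vector of an ALLL-reduced basis `B U`,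
`U ∈ GL_n(ℤ[ξ])`, of the compute-and-forward lattice with basis `B`. -/
def IsALLLCoeff (d : ℕ) (δ : ℝ) {n : ℕ} [NeZero n] (h : Fin n → ℂ) (P : ℝ)
    (a : Fin n → Zxi d) : Prop :=
  ∃ (L : Matrix (Fin n) (Fin n) ℂ) (D : Fin n → ℝ) (U : GL (Fin n) (Zxi d)),
    IsLDL (channelMatrix h P) L D ∧
    IsALLLReduced d δ (cfBasis L D * U.val.map (fun z => (z : ℂ))) ∧
    ∀ i, a i = U.val i 0

/-- The computation rate `log⁺ (1 / (a† (I + P h h†)⁻¹ a))`. -/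
def compRate {n : ℕ} (h a : Fin n → ℂ) (P : ℝ) : ℝ :=
  Real.posLog (1 / (star a ⬝ᵥ ((channelMatrix h P)⁻¹ *ᵥ a)).re)

/-- The degrees of freedom `lim_{P → ∞} R_comp(h, a, P) / log (1 + P)` of a coefficient vector
depending on `P` exist and equal `s`. -/
def HasDoF {n : ℕ} (h : Fin n → ℂ) (a : ℝ → Fin n → ℂ) (s : ℝ) : Prop :=
  Tendsto (fun P : ℝ => compRate h (a P) P / Real.log (1 + P)) atTop (𝓝 s)

end AlgLLL

end

namespace AlgLLL

/-! Write F for `quadForm h a P`; the claim is that F decays like P^(-1/n) up to factors P^ε. Upper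
bound: with β = δ - ρ² > 0, size reduction and Lovász's condition give β^j |R₀₀|² ≤ |R_jj|². Since ∏
|R_jj|² = 1 / (1 + P‖h‖²), the first reduced vector has F = |R₀₀|² = O(P^(-1/n))
(`IsALLLCoeff.quadForm_le`). Lower bound, for every nonzero a: `exists_quadForm_eq` writes a = v + t
h with F = ‖v‖² + |t|²/P, so ‖a‖ ≲ √(FP), while the minors a_i h_j - a_j h_i are O(√F). By
Borel–Cantelli, for almost every h some minor is at least c ‖a‖^(-s), for each s > 1/(n-1)
(`ae_exists_pos_le_norm_sub`). Hence F ≳ P^(-s/(1+s)), and s/(1+s) → 1/n as s → 1/(n-1). -/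

/-! ### Arithmetic of ℤ[ξ] -/

theorem exists_normSq_xi_combination (d : ℕ) (a b : ℤ) :
    ∃ k : ℤ, ‖(a : ℂ) + b * xi d‖ ^ 2 = k := by
  have hs : Real.sqrt d * Real.sqrt d = d := Real.mul_self_sqrt (Nat.cast_nonneg d)
  rw [← Complex.normSq_eq_norm_sq, Complex.normSq_apply, xi]
  split_ifs with h
  · obtain ⟨k, rfl⟩ : ∃ k, d = 4 * k + 3 := ⟨d / 4, by omega⟩
    refine ⟨a ^ 2 + a * b + b ^ 2 * (k + 1), ?_⟩
    simp at hs ⊢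
    linear_combination (b : ℝ) ^ 2 / 4 * hs
  · refine ⟨a ^ 2 + d * b ^ 2, ?_⟩
    simp
    linear_combination (b : ℝ) ^ 2 * hs

theorem exists_xi_mul_self (d : ℕ) : ∃ p q : ℤ, xi d * xi d = p + q * xi d := by
  have hs : (Real.sqrt d : ℂ) * Real.sqrt d = d := by
    exact_mod_cast Real.mul_self_sqrt (Nat.cast_nonneg d)
  rw [xi]
  split_ifs with h
  · obtain ⟨k, rfl⟩ : ∃ k, d = 4 * k + 3 := ⟨d / 4, by omega⟩
    refine ⟨-(k + 1), 1, ?_⟩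
    simp at hs ⊢
    linear_combination (-1 / 4 : ℂ) * hs + (Real.sqrt (4 * k + 3) : ℂ) ^ 2 / 4 * Complex.I_mul_I
  · refine ⟨-d, 0, ?_⟩
    simp
    linear_combination -hs + (Real.sqrt d : ℂ) ^ 2 * Complex.I_mul_I

theorem mem_Zxi_iff {d : ℕ} {z : ℂ} : z ∈ Zxi d ↔ ∃ a b : ℤ, z = a + b * xi d := by
  constructor
  · intro hz
    induction hz using Algebra.adjoin_induction with
    | mem x hx => exact ⟨0, 1, by simp_all⟩
    | algebraMap r => exact ⟨r, 0, by simp⟩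
    | add x y _ _ hx hy =>
      obtain ⟨a, b, rfl⟩ := hx
      obtain ⟨a', b', rfl⟩ := hy
      exact ⟨a + a', b + b', by push_cast; ring⟩
    | mul x y _ _ hx hy =>
      obtain ⟨a, b, rfl⟩ := hx
      obtain ⟨a', b', rfl⟩ := hy
      obtain ⟨p, q, h⟩ := exists_xi_mul_self d
      refine ⟨a * a' + b * b' * p, a * b' + a' * b + b * b' * q, ?_⟩
      push_cast
      linear_combination (b * b' : ℂ) * h
  · rintro ⟨a, b, rfl⟩
    exact add_mem (intCast_mem _ a)
      (mul_mem (intCast_mem _ b) (Algebra.self_mem_adjoin_singleton ℤ (xi d)))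

/-- The squared modulus is a positive integer. All discreteness used below comes from this. -/
theorem one_le_norm_of_mem_Zxi {d : ℕ} {z : ℂ} (hz : z ∈ Zxi d) (h0 : z ≠ 0) : 1 ≤ ‖z‖ := by
  obtain ⟨a, b, rfl⟩ := mem_Zxi_iff.1 hz
  obtain ⟨k, hk⟩ := exists_normSq_xi_combination d a b
  have hpos : (0 : ℝ) < k := hk ▸ by positivity
  have h1 : (1 : ℝ) ≤ k := by exact_mod_cast hpos
  rw [← hk] at h1
  exact (one_le_sq_iff₀ (norm_nonneg _)).1 h1

theorem norm_coe_unit (d : ℕ) (u : (Zxi d)ˣ) : ‖((u : Zxi d) : ℂ)‖ = 1 := by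
  have h : ((u : Zxi d) : ℂ) * ((u⁻¹ : (Zxi d)ˣ) : Zxi d) = 1 := by
    exact_mod_cast congrArg Subtype.val u.mul_inv
  have h1 := one_le_norm_of_mem_Zxi (u : Zxi d).2 (left_ne_zero_of_mul_eq_one h)
  have h2 := one_le_norm_of_mem_Zxi ((u⁻¹ : (Zxi d)ˣ) : Zxi d).2 (right_ne_zero_of_mul_eq_one h)
  have h3 := congrArg norm h
  rw [norm_mul, norm_one] at h3
  nlinarith

/-! ### ℤ[ξ]^n as a discrete subgroup of ℂ^n -/

/-- The vectors with entries in `ℤ[ξ]`, as the image of the integer coordinates. -/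
noncomputable def latticeMap (d n : ℕ) : (Fin n → ℤ × ℤ) →ₗ[ℤ] (Fin n → ℂ) where
  toFun x i := (x i).1 + (x i).2 * xi d
  map_add' x y := by ext i; simp; ring
  map_smul' c x := by ext i; simp; ring

theorem mem_range_latticeMap {d n : ℕ} {v : Fin n → ℂ} :
    v ∈ LinearMap.range (latticeMap d n) ↔ ∀ i, v i ∈ Zxi d := by
  constructor
  · rintro ⟨x, rfl⟩ i
    exact mem_Zxi_iff.2 ⟨_, _, rfl⟩
  · intro h
    choose a b hab using fun i => mem_Zxi_iff.1 (h i)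
    exact ⟨fun i => (a i, b i), funext fun i => (hab i).symm⟩

theorem one_le_norm_of_forall_mem_Zxi {d n : ℕ} {v : Fin n → ℂ} (hv : ∀ i, v i ∈ Zxi d)
    (h0 : v ≠ 0) : 1 ≤ ‖v‖ := by
  obtain ⟨i, hi⟩ := Function.ne_iff.1 h0
  exact (one_le_norm_of_mem_Zxi (hv i) hi).trans (norm_le_pi_norm v i)

instance discreteTopology_range_latticeMap (d n : ℕ) :
    DiscreteTopology (LinearMap.range (latticeMap d n)) :=
  DiscreteTopology.of_forall_le_norm one_pos fun x hx =>
    one_le_norm_of_forall_mem_Zxi (mem_range_latticeMap.1 x.2) fun h => hx (Subtype.ext h)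

/-- An inequality is enough for summability, and it holds even for d = 0, where ξ = 0. -/
theorem finrank_range_latticeMap_le (d n : ℕ) :
    Module.finrank ℤ (LinearMap.range (latticeMap d n)) ≤ 2 * n := by
  refine (LinearMap.finrank_range_le _).trans ?_
  simp [Module.finrank_pi_fintype]
  omega

theorem finite_norm_le (d n : ℕ) (C : ℝ) :
    {v : Fin n → ℂ | (∀ i, v i ∈ Zxi d) ∧ ‖v‖ ≤ C}.Finite := by
  have hd : DiscreteTopology (LinearMap.range (latticeMap d n)).toAddSubgroup :=
    discreteTopology_range_latticeMap d n
  have hc : IsClosed ((LinearMap.range (latticeMap d n)).toAddSubgroup : Set (Fin n → ℂ)) :=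
    AddSubgroup.isClosed_of_discrete
  refine (Metric.finite_isBounded_inter_isClosed ⟨hd⟩
    (Metric.isBounded_closedBall (x := (0 : Fin n → ℂ)) (r := C)) hc).subset ?_
  rintro v ⟨hv, hC⟩
  exact ⟨by simpa using hC, mem_range_latticeMap.2 hv⟩

theorem finite_norm_le_subtype (d n : ℕ) (C : ℝ) :
    {a : Fin n → Zxi d | ‖fun i => (a i : ℂ)‖ ≤ C}.Finite := by
  refine Set.Finite.of_finite_image ((finite_norm_le d n C).subset ?_)
    (f := fun a i => (a i : ℂ)) ?_
  · rintro _ ⟨a, ha, rfl⟩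
    exact ⟨fun i => (a i).2, ha⟩
  · intro a _ b _ hab
    exact funext fun i => Subtype.ext (congrFun hab i)

theorem summable_norm_rpow_Zxi (d n : ℕ) {r : ℝ} (hr : 2 * n < r) :
    Summable fun a : Fin n → Zxi d => ‖fun i => (a i : ℂ)‖ ^ (-r) := by
  have h1 : (Module.finrank ℤ (LinearMap.range (latticeMap d n)) : ℝ) ≤ 2 * n := by
    exact_mod_cast finrank_range_latticeMap_le d n
  have h : Summable fun z : LinearMap.range (latticeMap d n) => ‖(z : Fin n → ℂ)‖ ^ (-r) :=
    ZLattice.summable_norm_rpow (LinearMap.range (latticeMap d n)) (-r) (by linarith)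
  let e : (Fin n → Zxi d) → LinearMap.range (latticeMap d n) :=
    fun a => ⟨fun i => a i, mem_range_latticeMap.2 fun i => (a i).2⟩
  have he : Function.Injective e := fun a b hab =>
    funext fun i => Subtype.ext (congrFun (congrArg Subtype.val hab) i)
  simpa only [Function.comp_def, e] using h.comp_injective he

instance countable_Zxi (d : ℕ) : Countable (Zxi d) := by
  have : Function.Surjective
      (fun p : ℤ × ℤ => (⟨p.1 + p.2 * xi d, mem_Zxi_iff.2 ⟨_, _, rfl⟩⟩ : Zxi d)) := by
    rintro ⟨z, hz⟩
    obtain ⟨a, b, rfl⟩ := mem_Zxi_iff.1 hz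
    exact ⟨(a, b), rfl⟩
  exact this.countable

/-! ### Quantisation and the covering radius -/

theorem exists_nearest (d : ℕ) (x : ℂ) : ∃ q ∈ Zxi d, FullyReduced d (x - q) := by
  -- Elements of modulus above 2‖x‖ are farther from x than 0 is, so a finite search suffices.
  have hfin : {q : Fin 1 → Zxi d | ‖fun i => (q i : ℂ)‖ ≤ ‖x‖ + ‖x‖}.Finite :=
    finite_norm_le_subtype d 1 _
  obtain ⟨q, hq, hmin⟩ := hfin.exists_minimalFor (fun q => ‖x - q 0‖) _ ⟨0, by simp⟩
  refine ⟨q 0, (q 0).2, fun p hp => ?_⟩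
  have key : ∀ p ∈ Zxi d, ‖x - q 0‖ ≤ ‖x - p‖ := by
    have hmin' : ∀ p : Zxi d, ‖(p : ℂ)‖ ≤ ‖x‖ + ‖x‖ → ‖x - q 0‖ ≤ ‖x - p‖ := by
      intro p hp
      rcases le_total ‖x - q 0‖ ‖x - p‖ with h | h
      · exact h
      · exact hmin (j := fun _ => p) (by simpa using hp) h
    intro p hp
    by_cases h : ‖p‖ ≤ ‖x‖ + ‖x‖
    · exact hmin' ⟨p, hp⟩ h
    · have h0 := hmin' 0 (by simp)
      have h1 := norm_sub_norm_le p x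
      rw [norm_sub_rev] at h1
      simp at h0
      linarith
  simpa [sub_sub] using key _ (add_mem (q 0).2 hp)

theorem xi_im_pos {d : ℕ} (hd : 0 < d) : 0 < (xi d).im := by
  have : 0 < Real.sqrt d := Real.sqrt_pos.2 (Nat.cast_pos.2 hd)
  rw [xi]
  split_ifs <;> simp <;> positivity

/-- Rounding both coordinates. The bound is crude; it serves to show that the supremum in
`coveringRadius` is over a bounded family, hence not a default value. -/
theorem infDist_Zxi_le {d : ℕ} (hd : 0 < d) (x : ℂ) :
    Metric.infDist x (Zxi d : Set ℂ) ≤ 1 + (xi d).im := by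
  have hc := xi_im_pos hd
  set b : ℤ := round (x.im / (xi d).im)
  set a : ℤ := round (x.re - b * (xi d).re)
  refine (Metric.infDist_le_dist_of_mem (mem_Zxi_iff.2 ⟨a, b, rfl⟩)).trans ?_
  rw [dist_eq_norm]
  refine (Complex.norm_le_abs_re_add_abs_im _).trans (add_le_add ?_ ?_)
  · have := abs_sub_round (x.re - b * (xi d).re)
    simp
    rw [add_comm, ← sub_sub]
    linarith
  · have := abs_sub_round (x.im / (xi d).im)
    have h2 : x.im - b * (xi d).im = (x.im / (xi d).im - b) * (xi d).im := by
      field_simp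
    simp
    rw [h2, abs_mul, abs_of_pos hc]
    nlinarith

theorem FullyReduced.norm_le_coveringRadius {d : ℕ} (hd : 0 < d) {x : ℂ} (hx : FullyReduced d x) :
    ‖x‖ ≤ coveringRadius d := by
  refine le_trans ?_ (le_ciSup ⟨1 + (xi d).im, ?_⟩ x)
  · exact (Metric.le_infDist ⟨0, zero_mem (Zxi d)⟩).2 fun q hq => by
      simpa [dist_eq_norm] using hx q hq
  · rintro _ ⟨y, rfl⟩
    exact infDist_Zxi_le hd y

/-! ### QR and LDL decompositions -/

theorem exists_qr {n : ℕ} (B : Matrix (Fin n) (Fin n) ℂ) :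
    ∃ Q R : Matrix (Fin n) (Fin n) ℂ, Q ∈ Matrix.unitaryGroup (Fin n) ℂ ∧
      (∀ i j, j < i → R i j = 0) ∧ B = Q * R := by
  let f : Fin n → EuclideanSpace ℂ (Fin n) := fun j => WithLp.toLp 2 fun i => B i j
  have hn : Module.finrank ℂ (EuclideanSpace ℂ (Fin n)) = Fintype.card (Fin n) := by simp
  let b := InnerProductSpace.gramSchmidtOrthonormalBasis hn f
  let e := EuclideanSpace.basisFun (Fin n) ℂ
  refine ⟨e.toBasis.toMatrix b, b.toBasis.toMatrix f,
    e.toMatrix_orthonormalBasis_mem_unitary b, fun i j hij =>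
    InnerProductSpace.gramSchmidtOrthonormalBasis_inv_isUpperTriangular hn f hij, ?_⟩
  have := e.toBasis.toMatrix_mul_toMatrix b.toBasis f
  rw [OrthonormalBasis.coe_toBasis] at this
  rw [this]
  ext i j
  simp [Module.Basis.toMatrix_apply, e, f]

theorem norm_det_eq_of_qr {n : ℕ} {B Q R : Matrix (Fin n) (Fin n) ℂ}
    (hQ : Q ∈ Matrix.unitaryGroup (Fin n) ℂ) (hR : ∀ i j, j < i → R i j = 0) (hB : B = Q * R) :
    ‖B.det‖ = ∏ i, ‖R i i‖ := by
  have h := congrArg (fun z => ‖z‖) (congrArg Matrix.det (Matrix.mem_unitaryGroup_iff.1 hQ))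
  simp only [Matrix.star_eq_conjTranspose, Matrix.det_mul, Matrix.det_conjTranspose, norm_mul,
    norm_star, Matrix.det_one, norm_one] at h
  have h1 : ‖Q.det‖ = 1 := by nlinarith [norm_nonneg Q.det]
  rw [hB, Matrix.det_mul, norm_mul, h1, one_mul,
    Matrix.det_of_isUpperTriangular (fun i j hij => hR i j hij), norm_prod]

theorem conjTranspose_mul_self_of_qr {n : ℕ} {B Q R : Matrix (Fin n) (Fin n) ℂ}
    (hQ : Q ∈ Matrix.unitaryGroup (Fin n) ℂ) (hB : B = Q * R) : Bᴴ * B = Rᴴ * R := by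
  rw [hB, Matrix.conjTranspose_mul, Matrix.mul_assoc, ← Matrix.mul_assoc Qᴴ,
    ← Matrix.star_eq_conjTranspose Q, Matrix.mem_unitaryGroup_iff'.1 hQ, Matrix.one_mul]

open scoped ComplexOrder MatrixOrder in
-- A QR decomposition of N in M = N†N gives M = R†R; scaling the columns of R† to unit diagonal
-- gives L, with D the squared moduli |R_ii|².
theorem exists_isLDL {n : ℕ} {M : Matrix (Fin n) (Fin n) ℂ} (hM : M.PosDef) :
    ∃ L D, IsLDL M L D := by
  obtain ⟨N, hN⟩ := CStarAlgebra.nonneg_iff_eq_star_mul_self.1 hM.posSemidef.nonneg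
  obtain ⟨Q, R, hQ, hR, rfl⟩ := exists_qr N
  rw [Matrix.star_eq_conjTranspose, conjTranspose_mul_self_of_qr hQ rfl] at hN
  have hdet : ∀ i, R i i ≠ 0 := by
    have h := hM.det_pos.ne'
    rw [hN, Matrix.det_mul, Matrix.det_of_isUpperTriangular (fun i j hij => hR i j hij)] at h
    intro i hi
    exact h (by rw [Finset.prod_eq_zero (f := fun i => R i i) (Finset.mem_univ i) hi, mul_zero])
  refine ⟨Rᴴ * Matrix.diagonal fun i => (star (R i i))⁻¹, fun i => ‖R i i‖ ^ 2,
    fun i j hij => ?_, fun i => ?_, fun i => by have := hdet i; positivity, ?_⟩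
  · simp [Matrix.mul_diagonal, hR j i hij]
  · simp [Matrix.mul_diagonal, hdet i]
  · rw [hN, Matrix.conjTranspose_mul, Matrix.conjTranspose_conjTranspose,
      Matrix.diagonal_conjTranspose, ← Matrix.mul_assoc, Matrix.mul_assoc Rᴴ,
      Matrix.mul_assoc Rᴴ, Matrix.diagonal_mul_diagonal, Matrix.diagonal_mul_diagonal]
    have : (fun i => (star (R i i))⁻¹ * ((‖R i i‖ ^ 2 : ℝ) : ℂ) *
        star (fun i => (star (R i i))⁻¹) i) = 1 := by
      ext i
      have h1 := hdet i
      have h2 : star (R i i) ≠ 0 := star_ne_zero.2 h1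
      have h3 : ((‖R i i‖ ^ 2 : ℝ) : ℂ) = star (R i i) * R i i := by
        rw [← Complex.normSq_eq_norm_sq, Complex.normSq_eq_conj_mul_self]; rfl
      rw [h3]
      simp only [Pi.star_apply, star_inv₀, star_star, Pi.one_apply]
      field_simp
    rw [this]
    simp

/-! ### Block triangular matrices -/

/-- The block upper triangular matrix `[[r, v], [0, A]]`. -/
def blockUpper {R : Type*} [Zero R] {n : ℕ} (r : R) (v : Fin n → R) (A : Matrix (Fin n) (Fin n) R) :
    Matrix (Fin (n + 1)) (Fin (n + 1)) R :=
  Matrix.of (Fin.cons (Fin.cons r v) fun i => Fin.cons 0 (A i))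

section blockUpper

variable {R : Type*} {n : ℕ}

@[simp] theorem blockUpper_zero_zero [Zero R] (r : R) (v : Fin n → R)
    (A : Matrix (Fin n) (Fin n) R) : blockUpper r v A 0 0 = r := rfl

@[simp] theorem blockUpper_zero_succ [Zero R] (r : R) (v : Fin n → R)
    (A : Matrix (Fin n) (Fin n) R) (j : Fin n) : blockUpper r v A 0 j.succ = v j := rfl

@[simp] theorem blockUpper_succ_zero [Zero R] (r : R) (v : Fin n → R)
    (A : Matrix (Fin n) (Fin n) R) (i : Fin n) : blockUpper r v A i.succ 0 = 0 := rfl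

@[simp] theorem blockUpper_succ_succ [Zero R] (r : R) (v : Fin n → R)
    (A : Matrix (Fin n) (Fin n) R) (i j : Fin n) : blockUpper r v A i.succ j.succ = A i j := rfl

theorem eq_blockUpper [Zero R] {M : Matrix (Fin (n + 1)) (Fin (n + 1)) R}
    (hM : ∀ i : Fin n, M i.succ 0 = 0) :
    M = blockUpper (M 0 0) (fun j => M 0 j.succ) (M.submatrix Fin.succ Fin.succ) := by
  ext i j
  refine Fin.cases ?_ (fun i => ?_) i <;> refine Fin.cases ?_ (fun j => ?_) j <;> simp [hM]

theorem blockUpper_mul [CommRing R] (r s : R) (v w : Fin n → R) (A C : Matrix (Fin n) (Fin n) R) :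
    blockUpper r v A * blockUpper s w C = blockUpper (r * s) (r • w + v ᵥ* C) (A * C) := by
  ext i j
  refine Fin.cases ?_ (fun i => ?_) i <;> refine Fin.cases ?_ (fun j => ?_) j <;>
    simp [Matrix.mul_apply, Fin.sum_univ_succ, Matrix.vecMul, dotProduct]

theorem det_blockUpper [CommRing R] (r : R) (v : Fin n → R) (A : Matrix (Fin n) (Fin n) R) :
    (blockUpper r v A).det = r * A.det := by
  rw [Matrix.det_succ_column_zero, Fin.sum_univ_succ]
  have : (blockUpper r v A).submatrix Fin.succ Fin.succ = A := rfl
  simp [this]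

theorem blockUpper_mem_unitaryGroup {Q : Matrix (Fin n) (Fin n) ℂ}
    (hQ : Q ∈ Matrix.unitaryGroup (Fin n) ℂ) :
    blockUpper 1 0 Q ∈ Matrix.unitaryGroup (Fin (n + 1)) ℂ := by
  have hstar : star (blockUpper 1 0 Q) = blockUpper 1 0 (star Q) := by
    ext i j
    refine Fin.cases ?_ (fun i => ?_) i <;> refine Fin.cases ?_ (fun j => ?_) j <;> simp
  have hone : blockUpper (1 : ℂ) 0 (1 : Matrix (Fin n) (Fin n) ℂ) = 1 := by
    ext i j
    refine Fin.cases ?_ (fun i => ?_) i <;> refine Fin.cases ?_ (fun j => ?_) j <;>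
      simp [Matrix.one_apply, (Fin.succ_ne_zero _).symm]
  rw [Matrix.mem_unitaryGroup_iff, hstar, blockUpper_mul, Matrix.mem_unitaryGroup_iff.1 hQ]
  simpa using hone

end blockUpper

/-- The complex matrix with the entries of a matrix over `ℤ[ξ]`. -/
def toComplex {d n : ℕ} (U : Matrix (Fin n) (Fin n) (Zxi d)) : Matrix (Fin n) (Fin n) ℂ :=
  U.map fun z => (z : ℂ)

theorem toComplex_mul {d n : ℕ} (U V : Matrix (Fin n) (Fin n) (Zxi d)) :
    toComplex (U * V) = toComplex U * toComplex V := by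
  ext i j
  simp [toComplex, Matrix.mul_apply]

theorem det_toComplex {d n : ℕ} (U : Matrix (Fin n) (Fin n) (Zxi d)) :
    (toComplex U).det = (U.det : ℂ) :=
  ((Zxi d).val.toRingHom.map_det U).symm

theorem toComplex_blockUpper {d n : ℕ} (r : Zxi d) (v : Fin n → Zxi d)
    (A : Matrix (Fin n) (Fin n) (Zxi d)) :
    toComplex (blockUpper r v A) = blockUpper (r : ℂ) (fun i => (v i : ℂ)) (toComplex A) := by
  ext i j
  refine Fin.cases ?_ (fun i => ?_) i <;> refine Fin.cases ?_ (fun j => ?_) j <;> simp [toComplex]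

/-! ### Existence of reduced bases -/

/-- The diagonal entries of a Gram matrix are the squared Euclidean norms of the columns. -/
theorem conjTranspose_mul_self_apply_self {n : ℕ} (B : Matrix (Fin n) (Fin n) ℂ) (j : Fin n) :
    (Bᴴ * B) j j = ((∑ i, ‖B i j‖ ^ 2 : ℝ) : ℂ) := by
  rw [Matrix.mul_apply]
  push_cast
  refine Finset.sum_congr rfl fun i _ => ?_
  rw [Matrix.conjTranspose_apply, Complex.star_def, Complex.conj_mul']

theorem sum_norm_sq_column_of_qr {n : ℕ} {B Q R : Matrix (Fin n) (Fin n) ℂ}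
    (hQ : Q ∈ Matrix.unitaryGroup (Fin n) ℂ) (hB : B = Q * R) (j : Fin n) :
    ∑ i, ‖B i j‖ ^ 2 = ∑ i, ‖R i j‖ ^ 2 := by
  have h := congrFun (congrFun (conjTranspose_mul_self_of_qr hQ hB) j) j
  rw [conjTranspose_mul_self_apply_self, conjTranspose_mul_self_apply_self] at h
  exact_mod_cast h

theorem finite_sum_norm_sq_mulVec_le (d : ℕ) {n : ℕ} {B : Matrix (Fin n) (Fin n) ℂ}
    (hB : B.det ≠ 0) (K : ℝ) :
    {a : Fin n → Zxi d | ∑ i, ‖(B *ᵥ fun j => (a j : ℂ)) i‖ ^ 2 ≤ K}.Finite := by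
  let T := LinearMap.toContinuousLinearMap (Matrix.mulVecLin B⁻¹)
  refine (finite_norm_le_subtype d n (‖T‖ * Real.sqrt K)).subset fun a ha => ?_
  set v : Fin n → ℂ := fun j => (a j : ℂ)
  have hv : T (B *ᵥ v) = v := by
    simp [T, Matrix.mulVec_mulVec, Matrix.nonsing_inv_mul B (isUnit_iff_ne_zero.2 hB)]
  have h1 : ‖B *ᵥ v‖ ≤ Real.sqrt K := by
    refine (pi_norm_le_iff_of_nonneg (Real.sqrt_nonneg _)).2 fun i => Real.le_sqrt_of_sq_le ?_
    exact (Finset.single_le_sum (f := fun i => ‖(B *ᵥ v) i‖ ^ 2) (fun i _ => by positivity)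
      (Finset.mem_univ i)).trans ha
  calc ‖v‖ = ‖T (B *ᵥ v)‖ := by rw [hv]
    _ ≤ ‖T‖ * ‖B *ᵥ v‖ := T.le_opNorm _
    _ ≤ _ := by gcongr

/-- Among all bases of a lattice there is one whose first vector is as short as possible. -/
theorem exists_shortest_first_column (d : ℕ) {n : ℕ} {B : Matrix (Fin (n + 1)) (Fin (n + 1)) ℂ}
    (hB : B.det ≠ 0) :
    ∃ U : Matrix (Fin (n + 1)) (Fin (n + 1)) (Zxi d), IsUnit U.det ∧
      ∀ V : Matrix (Fin (n + 1)) (Fin (n + 1)) (Zxi d), IsUnit V.det →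
        ∀ j, ∑ i, ‖(B * toComplex U) i 0‖ ^ 2 ≤ ∑ i, ‖(B * toComplex V) i j‖ ^ 2 := by
  let F : (Fin (n + 1) → Zxi d) → ℝ := fun a => ∑ i, ‖(B *ᵥ fun j => (a j : ℂ)) i‖ ^ 2
  have hF : ∀ (V : Matrix (Fin (n + 1)) (Fin (n + 1)) (Zxi d)) j,
      ∑ i, ‖(B * toComplex V) i j‖ ^ 2 = F fun i => V i j := fun V j => rfl
  -- Only vectors that extend to a basis compete: ℤ[ξ] need not be principal, so a shortest lattice
  -- vector need not extend.
  let S : Set (Fin (n + 1) → Zxi d) :=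
    {a | ∃ U : Matrix (Fin (n + 1)) (Fin (n + 1)) (Zxi d), IsUnit U.det ∧ a = fun i => U i 0}
  let e : Fin (n + 1) → Zxi d := fun i => (1 : Matrix (Fin (n + 1)) (Fin (n + 1)) (Zxi d)) i 0
  have he : e ∈ S := ⟨1, by simp, rfl⟩
  have hfin : {a | a ∈ S ∧ F a ≤ F e}.Finite :=
    (finite_sum_norm_sq_mulVec_le d hB (F e)).subset fun a ha => ha.2
  obtain ⟨a, ⟨⟨U, hU, rfl⟩, haF⟩, hmin⟩ := hfin.exists_minimalFor F _ ⟨e, he, le_rfl⟩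
  refine ⟨U, hU, fun V hV j => ?_⟩
  rw [hF, hF]
  have hVS : (fun i => V i j) ∈ S := by
    refine ⟨V.submatrix id (Equiv.swap 0 j), ?_, by ext i; simp⟩
    rw [Matrix.det_permute']
    exact IsUnit.mul ((Units.isUnit _).map (Int.castRingHom (Zxi d))) hV
  rcases le_total (F fun i => U i 0) (F fun i => V i j) with h | h
  · exact h
  · exact hmin ⟨hVS, h.trans haF⟩ h

/-- Induction instead of termination of the algorithm, so that δ = 1 is covered: take a shortest
vector that extends to a basis, reduce the projection of the lattice orthogonal to it, then
size-reduce the first row. -/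
theorem exists_isALLLReduced (d : ℕ) {δ : ℝ} (hδ1 : δ ≤ 1) :
    ∀ {n : ℕ} {B : Matrix (Fin n) (Fin n) ℂ}, B.det ≠ 0 →
      ∃ U : Matrix (Fin n) (Fin n) (Zxi d), IsUnit U.det ∧
        IsALLLReduced d δ (B * toComplex U) := by
  intro n
  induction n with
  | zero =>
    intro B _
    refine ⟨1, by simp, 1, B * toComplex (d := d) 1, one_mem _, ?_, by simp, ?_, ?_⟩ <;>
      exact fun i => i.elim0
  | succ n ih =>
    intro B hB
    obtain ⟨U₁, hU₁, hmin⟩ := exists_shortest_first_column d hB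
    obtain ⟨Q₁, R₁, hQ₁, hR₁, h₁⟩ := exists_qr (B * toComplex U₁)
    have hblock := eq_blockUpper fun i : Fin n => hR₁ i.succ 0 (Fin.succ_pos i)
    set r := R₁ 0 0
    set v : Fin n → ℂ := fun j => R₁ 0 j.succ
    set B' := R₁.submatrix Fin.succ Fin.succ
    have hdet : R₁.det ≠ 0 := by
      have h : (B * toComplex U₁).det ≠ 0 := by
        rw [Matrix.det_mul, det_toComplex]
        exact mul_ne_zero hB fun h => (hU₁.ne_zero (Subtype.ext h))
      rw [h₁, Matrix.det_mul] at h
      exact right_ne_zero_of_mul h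
    rw [hblock, det_blockUpper] at hdet
    have hr : r ≠ 0 := left_ne_zero_of_mul hdet
    obtain ⟨U', hU', Q', R', hQ', hR', h', hsize, hlov⟩ := ih (right_ne_zero_of_mul hdet)
    -- Subtracting q_j times the first column from column j + 1 quantises the first row and leaves
    -- the lower block untouched.
    choose q hq hqred using fun j => exists_nearest d ((v ᵥ* toComplex U') j / r)
    let w : Fin n → Zxi d := fun j => -⟨q j, hq j⟩
    let x : Fin n → ℂ := r • (fun i => (w i : ℂ)) + v ᵥ* toComplex U'
    have hfac : B * toComplex (U₁ * blockUpper 1 w U') =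
        (Q₁ * blockUpper 1 0 Q') * blockUpper r x R' := by
      rw [toComplex_mul, ← Matrix.mul_assoc, h₁, Matrix.mul_assoc, Matrix.mul_assoc, hblock,
        toComplex_blockUpper, blockUpper_mul, h', blockUpper_mul]
      simp [x]
    have hunit : IsUnit (U₁ * blockUpper 1 w U').det := by
      rw [Matrix.det_mul, det_blockUpper, one_mul]
      exact hU₁.mul hU'
    have hQ := mul_mem hQ₁ (blockUpper_mem_unitaryGroup hQ')
    refine ⟨_, hunit, _, _, hQ, ?_, hfac, ?_, ?_⟩
    · intro i j
      refine Fin.cases (fun h => absurd h (Fin.not_lt_zero _)) (fun i => ?_) i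
      refine Fin.cases (fun _ => rfl) (fun j h => ?_) j
      exact hR' i j (Fin.succ_lt_succ_iff.1 h)
    · intro j k
      refine Fin.cases (fun h => absurd h (Fin.not_lt_zero _)) (fun k => ?_) k
      refine Fin.cases (fun _ => ?_) (fun j h => ?_) j
      · have : x k / r = (v ᵥ* toComplex U') k / r - q k := by
          simp [x, w]
          field_simp
          ring
        simpa [this] using hqred k
      · exact hsize j k (Fin.succ_lt_succ_iff.1 h)
    · intro i j
      refine Fin.cases (fun h => by simp at h) (fun j => ?_) j
      refine Fin.cases (fun h => ?_) (fun i h => ?_) i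
      · have hj : (j : ℕ) = 0 := by simpa using h.symm
        -- The second column also starts some basis, so it is no shorter than the first: |r|² ≤
        -- |x₀|² + |R'₀₀|². This is Lovász's condition with parameter 1.
        have h1 := hmin _ hunit j.succ
        have h2 : ∑ i, ‖R' i j‖ ^ 2 = ‖R' j j‖ ^ 2 := by
          refine Finset.sum_eq_single_of_mem j (Finset.mem_univ j) fun b _ hb => ?_
          have : j < b := by
            rw [Fin.lt_def, hj]
            exact Nat.pos_of_ne_zero fun h => hb (Fin.ext (h.trans hj.symm))
          simp [hR' b j this]
        rw [sum_norm_sq_column_of_qr hQ hfac, sum_norm_sq_column_of_qr hQ₁ h₁, hblock,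
          Fin.sum_univ_succ, Fin.sum_univ_succ] at h1
        simp [h2] at h1 ⊢
        nlinarith [sq_nonneg ‖r‖]
      · exact hlov i j (by simpa using h)

/-! ### The channel matrix and the compute-and-forward lattice -/

open scoped ComplexOrder in
theorem posDef_channelMatrix {n : ℕ} (h : Fin n → ℂ) {P : ℝ} (hP : 0 ≤ P) :
    (channelMatrix h P).PosDef := by
  refine Matrix.PosDef.one.add_posSemidef ?_
  exact (Matrix.posSemidef_vecMulVec_self_star h).smul (by exact_mod_cast hP)

theorem det_channelMatrix {n : ℕ} (h : Fin n → ℂ) (P : ℝ) :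
    (channelMatrix h P).det = ((1 + P * ∑ i, ‖h i‖ ^ 2 : ℝ) : ℂ) := by
  have := Matrix.det_one_add_replicateCol_mul_replicateRow (ι := Unit) ((P : ℂ) • h) (star h)
  rw [← Matrix.vecMulVec_eq, Matrix.smul_vecMulVec] at this
  rw [channelMatrix, this, dotProduct, Finset.mul_sum]
  push_cast
  congr 1
  refine Finset.sum_congr rfl fun i _ => ?_
  rw [← Complex.conj_mul', Pi.smul_apply, Pi.star_apply, smul_eq_mul, Complex.star_def]
  ring

theorem IsLDL.det_eq_one {n : ℕ} {M L : Matrix (Fin n) (Fin n) ℂ} {D : Fin n → ℝ}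
    (h : IsLDL M L D) : L.det = 1 := by
  rw [Matrix.det_of_isLowerTriangular L fun i j hij => h.1 i j hij]
  exact Finset.prod_eq_one fun i _ => h.2.1 i

theorem IsLDL.conjTranspose_cfBasis_mul_cfBasis {n : ℕ} {M L : Matrix (Fin n) (Fin n) ℂ}
    {D : Fin n → ℝ} (h : IsLDL M L D) : (cfBasis L D)ᴴ * cfBasis L D = M⁻¹ := by
  have hL : IsUnit L.det := by rw [h.det_eq_one]; exact isUnit_one
  have hL' : IsUnit Lᴴ.det := by rw [Matrix.det_conjTranspose, h.det_eq_one]; simp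
  refine (Matrix.inv_eq_left_inv ?_).symm
  set E : Matrix (Fin n) (Fin n) ℂ := Matrix.diagonal fun i => (((Real.sqrt (D i))⁻¹ : ℝ) : ℂ)
    with hE
  have hEE : Eᴴ * E * Matrix.diagonal (fun i => (D i : ℂ)) = 1 := by
    rw [hE, Matrix.diagonal_conjTranspose, Matrix.diagonal_mul_diagonal,
      Matrix.diagonal_mul_diagonal, ← Matrix.diagonal_one]
    congr 1
    ext i
    have h1 := Real.mul_self_sqrt (h.2.2.1 i).le
    have h2 : Real.sqrt (D i) ≠ 0 := (Real.sqrt_pos.2 (h.2.2.1 i)).ne'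
    simp only [Pi.star_apply, Complex.star_def, Complex.conj_ofReal]
    norm_cast
    field_simp
    nlinarith
  calc (cfBasis L D)ᴴ * cfBasis L D * M
      = (L⁻¹)ᴴ * (Eᴴ * E) * (L⁻¹ * L) * Matrix.diagonal (fun i => (D i : ℂ)) * Lᴴ := by
        rw [h.2.2.2, cfBasis, ← hE, Matrix.conjTranspose_mul]
        simp only [Matrix.mul_assoc]
    _ = (L⁻¹)ᴴ * (Eᴴ * E * Matrix.diagonal (fun i => (D i : ℂ))) * Lᴴ := by
        rw [Matrix.nonsing_inv_mul L hL, Matrix.mul_one]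
        simp only [Matrix.mul_assoc]
    _ = 1 := by
        rw [hEE, Matrix.mul_one, Matrix.conjTranspose_nonsing_inv, Matrix.nonsing_inv_mul _ hL']

theorem IsLDL.norm_det_cfBasis_sq {n : ℕ} {M L : Matrix (Fin n) (Fin n) ℂ}
    {D : Fin n → ℝ} (h : IsLDL M L D) : ‖(cfBasis L D).det‖ ^ 2 = ‖M.det‖⁻¹ := by
  have h1 := congrArg (fun A => ‖Matrix.det A‖) h.conjTranspose_cfBasis_mul_cfBasis
  simp only [Matrix.det_mul, Matrix.det_conjTranspose, norm_mul, norm_star,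
    Matrix.det_nonsing_inv, Ring.inverse_eq_inv', norm_inv] at h1
  rw [sq, h1]

open scoped ComplexOrder in
theorem exists_isALLLCoeff (d : ℕ) {δ : ℝ} (hδ1 : δ ≤ 1) {n : ℕ} [NeZero n] (h : Fin n → ℂ)
    {P : ℝ} (hP : 0 < P) : ∃ a : Fin n → Zxi d, IsALLLCoeff d δ h P a := by
  have hpos := posDef_channelMatrix h hP.le
  obtain ⟨L, D, hLD⟩ := exists_isLDL hpos
  have hdet : (cfBasis L D).det ≠ 0 := by
    have h1 := hLD.norm_det_cfBasis_sq
    intro h0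
    rw [h0, norm_zero, zero_pow two_ne_zero, eq_comm, inv_eq_zero, norm_eq_zero] at h1
    exact hpos.det_pos.ne' h1
  obtain ⟨U, hU, hred⟩ := exists_isALLLReduced d hδ1 hdet
  exact ⟨fun i => U i 0, L, D, Matrix.nonsingInvUnit U hU, hLD, hred, fun i => rfl⟩

/-- The quadratic form `a† (I + P h h†)⁻¹ a`. -/
noncomputable def quadForm {n : ℕ} (h a : Fin n → ℂ) (P : ℝ) : ℝ :=
  (star a ⬝ᵥ ((channelMatrix h P)⁻¹ *ᵥ a)).re

/-! ### Upper bound on the quadratic form -/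

/-- Size reduction bounds |R_{j-1,j}| by ρ |R_{j-1,j-1}|, so by Lovász's condition each step down
the diagonal loses at most a factor δ - ρ². -/
theorem sq_norm_le_of_isALLLReduced {d : ℕ} (hd : 0 < d) {δ : ℝ} {n : ℕ} [NeZero n]
    (hδ : coveringRadius d ^ 2 ≤ δ) {R : Matrix (Fin n) (Fin n) ℂ} (hR0 : ∀ i, R i i ≠ 0)
    (hsize : ∀ j k, j < k → FullyReduced d (R j k / R j j))
    (hlov : ∀ i j : Fin n, (i : ℕ) + 1 = j → δ * ‖R i i‖ ^ 2 ≤ ‖R j j‖ ^ 2 + ‖R i j‖ ^ 2)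
    (j : Fin n) : (δ - coveringRadius d ^ 2) ^ (j : ℕ) * ‖R 0 0‖ ^ 2 ≤ ‖R j j‖ ^ 2 := by
  obtain ⟨k, hk⟩ := j
  induction k with
  | zero => simp [show (⟨0, hk⟩ : Fin n) = 0 from Fin.ext (by simp)]
  | succ k ih =>
    have ih := ih (by omega)
    set i : Fin n := ⟨k, by omega⟩
    set j : Fin n := ⟨k + 1, hk⟩
    have h1 : ‖R i j‖ ≤ coveringRadius d * ‖R i i‖ := by
      have h := (hsize i j (by simp [i, j])).norm_le_coveringRadius hd
      rwa [norm_div, div_le_iff₀ (norm_pos_iff.2 (hR0 i))] at h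
    have h2 : ‖R i j‖ ^ 2 ≤ coveringRadius d ^ 2 * ‖R i i‖ ^ 2 := by
      rw [← mul_pow]; gcongr
    have h3 := hlov i j rfl
    have h4 := mul_le_mul_of_nonneg_left ih (sub_nonneg.2 hδ)
    simp only [i, j] at h4 ⊢
    rw [pow_succ']
    nlinarith

theorem IsALLLCoeff.ne_zero {d : ℕ} {δ : ℝ} {n : ℕ} [NeZero n] {h : Fin n → ℂ} {P : ℝ}
    {a : Fin n → Zxi d} (ha : IsALLLCoeff d δ h P a) : a ≠ 0 := by
  obtain ⟨-, -, U, -, -, haU⟩ := ha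
  intro h0
  have hU : IsUnit (U.val).det := (Matrix.isUnit_iff_isUnit_det _).1 U.isUnit
  refine hU.ne_zero (Matrix.det_eq_zero_of_column_eq_zero 0 fun i => ?_)
  rw [← haU, h0, Pi.zero_apply]

theorem IsALLLCoeff.quadForm_le {d : ℕ} (hd : 0 < d) {δ : ℝ} (hδ : coveringRadius d ^ 2 ≤ δ)
    (hδ1 : δ ≤ 1) {n : ℕ} [NeZero n] {h : Fin n → ℂ} {P : ℝ} (hP : 0 ≤ P)
    {a : Fin n → Zxi d} (ha : IsALLLCoeff d δ h P a) :
    ((δ - coveringRadius d ^ 2) ^ n * quadForm h (fun i => (a i : ℂ)) P) ^ n *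
      (1 + P * ∑ i, ‖h i‖ ^ 2) ≤ 1 := by
  obtain ⟨L, D, U, hLD, ⟨Q, R, hQ, hR, hB, hsize, hlov⟩, haU⟩ := ha
  change cfBasis L D * toComplex U.val = Q * R at hB
  have hquad : quadForm h (fun i => (a i : ℂ)) P = ‖R 0 0‖ ^ 2 := by
    have h1 : star (fun i => (a i : ℂ)) ⬝ᵥ ((channelMatrix h P)⁻¹ *ᵥ fun i => (a i : ℂ)) =
        ((cfBasis L D * toComplex U.val)ᴴ * (cfBasis L D * toComplex U.val)) 0 0 := by
      have hcol : (fun i => (a i : ℂ)) = fun i => toComplex U.val i 0 :=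
        funext fun i => by rw [haU i]; rfl
      rw [← hLD.conjTranspose_cfBasis_mul_cfBasis, hcol, Matrix.conjTranspose_mul,
        Matrix.mul_assoc, ← Matrix.mul_assoc (cfBasis L D)ᴴ]
      rfl
    rw [quadForm, h1, conjTranspose_mul_self_apply_self, sum_norm_sq_column_of_qr hQ hB,
      Complex.ofReal_re]
    refine Finset.sum_eq_single_of_mem 0 (Finset.mem_univ _) fun b _ hb => ?_
    have hb' : 0 < b := lt_of_le_of_ne (Fin.zero_le b) hb.symm
    simp [hR b 0 hb']
  have hdetM : ‖(channelMatrix h P).det‖ = 1 + P * ∑ i, ‖h i‖ ^ 2 := by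
    rw [det_channelMatrix, Complex.norm_real, Real.norm_of_nonneg (by positivity)]
  have hMpos : 0 < 1 + P * ∑ i, ‖h i‖ ^ 2 := by positivity
  have hprod : (∏ i, ‖R i i‖ ^ 2) * (1 + P * ∑ i, ‖h i‖ ^ 2) = 1 := by
    have hU : IsUnit (U.val).det := (Matrix.isUnit_iff_isUnit_det _).1 U.isUnit
    have h2 : ‖(toComplex U.val).det‖ = 1 := by
      rw [det_toComplex]
      exact norm_coe_unit d hU.unit
    rw [Finset.prod_pow, ← norm_det_eq_of_qr hQ hR hB, Matrix.det_mul, norm_mul, h2, mul_one,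
      hLD.norm_det_cfBasis_sq, hdetM]
    exact inv_mul_cancel₀ hMpos.ne'
  have hR0 : ∀ i, R i i ≠ 0 := by
    intro i hi
    rw [Finset.prod_eq_zero (Finset.mem_univ i) (by simp [hi]), zero_mul] at hprod
    exact zero_ne_one hprod
  have hβ : 0 ≤ δ - coveringRadius d ^ 2 := sub_nonneg.2 hδ
  have hβ1 : δ - coveringRadius d ^ 2 ≤ 1 := by nlinarith [sq_nonneg (coveringRadius d)]
  -- Weakening β^i to β^n (as β ≤ 1) makes the bound uniform in i; constants do not affect the
  -- degrees of freedom.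
  have hle : ∀ i, (δ - coveringRadius d ^ 2) ^ n * ‖R 0 0‖ ^ 2 ≤ ‖R i i‖ ^ 2 := fun i =>
    le_trans (mul_le_mul_of_nonneg_right (pow_le_pow_of_le_one hβ hβ1 i.2.le) (sq_nonneg _))
      (sq_norm_le_of_isALLLReduced hd hδ hR0 hsize hlov i)
  rw [hquad]
  refine le_trans (mul_le_mul_of_nonneg_right ?_ hMpos.le) hprod.le
  calc ((δ - coveringRadius d ^ 2) ^ n * ‖R 0 0‖ ^ 2) ^ n
      = ∏ _i : Fin n, (δ - coveringRadius d ^ 2) ^ n * ‖R 0 0‖ ^ 2 := by simp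
    _ ≤ _ := Finset.prod_le_prod (fun i _ => by positivity) fun i _ => hle i

/-! ### The quadratic form and approximation of the line ℂh -/

open scoped ComplexOrder in
theorem exists_quadForm_eq {n : ℕ} (h a : Fin n → ℂ) {P : ℝ} (hP : 0 < P) :
    ∃ (v : Fin n → ℂ) (t : ℂ), a = v + t • h ∧
      quadForm h a P = ∑ i, ‖v i‖ ^ 2 + ‖t‖ ^ 2 / P := by
  have hdet : IsUnit (channelMatrix h P).det :=
    isUnit_iff_ne_zero.2 (posDef_channelMatrix h hP.le).det_pos.ne'
  set v := (channelMatrix h P)⁻¹ *ᵥ a with hv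
  have ha : a = v + (P * (star h ⬝ᵥ v)) • h := by
    have h1 : channelMatrix h P *ᵥ v = a := by
      rw [hv, Matrix.mulVec_mulVec, Matrix.mul_nonsing_inv _ hdet, Matrix.one_mulVec]
    rw [← h1, channelMatrix, Matrix.add_mulVec, Matrix.one_mulVec, Matrix.smul_mulVec,
      Matrix.vecMulVec_mulVec]
    ext i
    simp
    ring
  refine ⟨v, _, ha, ?_⟩
  set w := star h ⬝ᵥ v with hw
  have hvv : star v ⬝ᵥ v = ((∑ i, ‖v i‖ ^ 2 : ℝ) : ℂ) := by
    rw [dotProduct]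
    push_cast
    refine Finset.sum_congr rfl fun i _ => ?_
    rw [Pi.star_apply, Complex.star_def, Complex.conj_mul']
  have h2 : star a ⬝ᵥ v = ((∑ i, ‖v i‖ ^ 2 + ‖(P : ℂ) * w‖ ^ 2 / P : ℝ) : ℂ) := by
    have h3 : star a = star v + (P * star w) • star h := by
      conv_lhs => rw [ha]
      simp
    rw [h3, add_dotProduct, hvv, smul_dotProduct, ← hw, smul_eq_mul, mul_assoc,
      Complex.star_def, Complex.conj_mul', norm_mul, Complex.norm_real,
      Real.norm_of_nonneg hP.le]
    have : (P : ℂ) ≠ 0 := by exact_mod_cast hP.ne'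
    push_cast
    field_simp
  rw [quadForm, ← hv, h2, Complex.ofReal_re]

theorem quadForm_nonneg {n : ℕ} (h a : Fin n → ℂ) {P : ℝ} (hP : 0 < P) : 0 ≤ quadForm h a P := by
  obtain ⟨v, t, -, hF⟩ := exists_quadForm_eq h a hP
  rw [hF]
  positivity

/-- In a = v + t h one has ‖v‖ ≤ √F and |t| ≤ √(FP). The minors against h do not see t h, so they
are controlled by v alone. -/
theorem norm_le_of_quadForm {n : ℕ} (h a : Fin n → ℂ) {P : ℝ} (hP : 1 ≤ P) :
    ‖a‖ ≤ Real.sqrt (quadForm h a P) * Real.sqrt P * (1 + ‖h‖) ∧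
      ∀ i j, ‖a i * h j - a j * h i‖ ≤ Real.sqrt (quadForm h a P) * (2 * ‖h‖) := by
  have hP0 : 0 < P := by linarith
  obtain ⟨v, t, rfl, hF⟩ := exists_quadForm_eq h a hP0
  set F := quadForm h (v + t • h) P
  have hvi : ∀ i, ‖v i‖ ≤ Real.sqrt F := fun i => by
    refine Real.le_sqrt_of_sq_le ?_
    have := Finset.single_le_sum (f := fun i => ‖v i‖ ^ 2) (fun i _ => by positivity)
      (Finset.mem_univ i)
    have h2 : 0 ≤ ‖t‖ ^ 2 / P := by positivity
    linarith
  have hv : ‖v‖ ≤ Real.sqrt F := (pi_norm_le_iff_of_nonneg (Real.sqrt_nonneg _)).2 hvi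
  have ht : ‖t‖ ≤ Real.sqrt F * Real.sqrt P := by
    rw [← Real.sqrt_mul' _ hP0.le]
    refine Real.le_sqrt_of_sq_le ((div_le_iff₀ hP0).1 ?_)
    have : 0 ≤ ∑ i, ‖v i‖ ^ 2 := by positivity
    linarith
  have hsP : 1 ≤ Real.sqrt P := Real.one_le_sqrt.2 hP
  constructor
  · calc ‖v + t • h‖ ≤ ‖v‖ + ‖t‖ * ‖h‖ := (norm_add_le _ _).trans (by rw [norm_smul])
      _ ≤ Real.sqrt F * Real.sqrt P + Real.sqrt F * Real.sqrt P * ‖h‖ := by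
          gcongr
          exact hv.trans (le_mul_of_one_le_right (Real.sqrt_nonneg _) hsP)
      _ = _ := by ring
  · intro i j
    have h1 : (v + t • h) i * h j - (v + t • h) j * h i = v i * h j - v j * h i := by
      simp
      ring
    rw [h1]
    calc ‖v i * h j - v j * h i‖ ≤ ‖v i‖ * ‖h j‖ + ‖v j‖ * ‖h i‖ :=
          (norm_sub_le _ _).trans (by rw [norm_mul, norm_mul])
      _ ≤ Real.sqrt F * ‖h‖ + Real.sqrt F * ‖h‖ := by
          gcongr
          exacts [hvi i, norm_le_pi_norm h j, hvi j, norm_le_pi_norm h i]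
      _ = _ := by ring

/-! ### Borel–Cantelli for directions over ℤ[ξ] -/

/-- Fubini: once h i is fixed, the other coordinates lie in a ball of radius r in ℂ^m, of real
dimension 2m. -/
theorem volume_slab_le {m : ℕ} (i : Fin (m + 1)) (c : Fin m → ℂ) (M : ℝ) {r : ℝ} (hr : 0 ≤ r) :
    volume {h : Fin (m + 1) → ℂ | ‖h i‖ ≤ M ∧ ∀ j, ‖h (i.succAbove j) - c j * h i‖ ≤ r} ≤
      volume (Metric.closedBall (0 : ℂ) M) *
        (ENNReal.ofReal (r ^ (2 * m)) * volume (Metric.ball (0 : Fin m → ℂ) 1)) := by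
  let S : Set (ℂ × (Fin m → ℂ)) := {p | ‖p.1‖ ≤ M ∧ ‖p.2 - p.1 • c‖ ≤ r}
  have hS : MeasurableSet S := by
    have h1 : IsClosed {p : ℂ × (Fin m → ℂ) | ‖p.1‖ ≤ M} :=
      isClosed_le (by fun_prop) continuous_const
    have h2 : IsClosed {p : ℂ × (Fin m → ℂ) | ‖p.2 - p.1 • c‖ ≤ r} :=
      isClosed_le (by fun_prop) continuous_const
    exact (h1.inter h2).measurableSet
  have hmp := volume_preserving_piFinSuccAbove (fun _ : Fin (m + 1) => ℂ) i
  have hset : {h : Fin (m + 1) → ℂ | ‖h i‖ ≤ M ∧ ∀ j, ‖h (i.succAbove j) - c j * h i‖ ≤ r} =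
      MeasurableEquiv.piFinSuccAbove (fun _ : Fin (m + 1) => ℂ) i ⁻¹' S := by
    ext h
    simp [S, Fin.removeNth, pi_norm_le_iff_of_nonneg hr, mul_comm]
  rw [hset, hmp.measure_preimage hS.nullMeasurableSet, Measure.volume_eq_prod,
    Measure.prod_apply hS, mul_comm, ← lintegral_indicator_const Metric.isClosed_closedBall.measurableSet]
  refine lintegral_mono fun x => ?_
  by_cases hx : x ∈ Metric.closedBall (0 : ℂ) M
  · rw [Set.indicator_of_mem hx]
    have hsub : Prod.mk x ⁻¹' S ⊆ Metric.closedBall (x • c) r := by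
      rintro y ⟨-, hy⟩
      simpa [dist_eq_norm] using hy
    refine (measure_mono hsub).trans ?_
    rw [Measure.addHaar_closedBall _ _ hr]
    simp [Module.finrank_pi_fintype, mul_comm]
  · have hempty : Prod.mk x ⁻¹' S = ∅ := by
      ext y
      simp at hx
      simp [S, hx]
    simp [hempty]

/-- The channels `h` in the ball of radius `M` which are close to the direction of `a`. -/
def nearDirection {n : ℕ} (M s : ℝ) (a : Fin n → ℂ) : Set (Fin n → ℂ) :=
  {h | a ≠ 0 ∧ ‖h‖ ≤ M ∧ ∀ i j, ‖a i * h j - a j * h i‖ ≤ ‖a‖ ^ (-s)}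

theorem volume_nearDirection_le {m : ℕ} (M s : ℝ) (a : Fin (m + 1) → ℂ) :
    volume (nearDirection M s a) ≤ ENNReal.ofReal (‖a‖ ^ (-((s + 1) * (2 * m)))) *
      (volume (Metric.closedBall (0 : ℂ) M) * volume (Metric.ball (0 : Fin m → ℂ) 1)) := by
  rcases eq_or_ne a 0 with rfl | ha
  · simp [nearDirection]
  -- Dividing the minors by the largest coordinate improves the radius from ‖a‖^(-s) to
  -- ‖a‖^(-(s+1)).
  obtain ⟨i, hi⟩ : ∃ i, ‖a i‖ = ‖a‖ := by
    obtain ⟨i, hi⟩ := Finite.exists_max fun i => ‖a i‖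
    exact ⟨i, le_antisymm (norm_le_pi_norm a i)
      ((pi_norm_le_iff_of_nonneg (norm_nonneg _)).2 hi)⟩
  have hpos : 0 < ‖a‖ := norm_pos_iff.2 ha
  have hai : a i ≠ 0 := norm_pos_iff.1 (hi ▸ hpos)
  have hr : 0 ≤ ‖a‖ ^ (-(s + 1)) := by positivity
  have hsub : nearDirection M s a ⊆ {h | ‖h i‖ ≤ M ∧
      ∀ j, ‖h (i.succAbove j) - a (i.succAbove j) / a i * h i‖ ≤ ‖a‖ ^ (-(s + 1))} := by
    rintro h ⟨-, hM, hh⟩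
    refine ⟨(norm_le_pi_norm h i).trans hM, fun j => ?_⟩
    have h1 : h (i.succAbove j) - a (i.succAbove j) / a i * h i =
        (a i * h (i.succAbove j) - a (i.succAbove j) * h i) / a i := by
      field_simp
    rw [h1, norm_div, hi, div_le_iff₀ hpos, ← Real.rpow_add_one hpos.ne']
    simpa using hh i (i.succAbove j)
  refine (measure_mono hsub).trans ((volume_slab_le i _ M hr).trans_eq ?_)
  have h2 : (‖a‖ ^ (-(s + 1))) ^ (2 * m) = ‖a‖ ^ (-((s + 1) * (2 * m))) := by
    rw [← Real.rpow_mul_natCast hpos.le]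
    congr 1
    push_cast
    ring
  rw [h2]
  ring

theorem ae_finite_nearDirection (d : ℕ) {m : ℕ} (hm : 0 < m) (M : ℝ) {s : ℝ}
    (hs : 1 / (m : ℝ) < s) :
    ∀ᵐ h : Fin (m + 1) → ℂ,
      {a : Fin (m + 1) → Zxi d | h ∈ nearDirection M s fun i => (a i : ℂ)}.Finite := by
  refine ae_finite_setOfPred_mem (ne_top_of_le_ne_top ?_
    (ENNReal.tsum_le_tsum fun a => volume_nearDirection_le M s fun i => (a i : ℂ)))
  rw [ENNReal.tsum_mul_right]
  refine ENNReal.mul_ne_top ?_ (ENNReal.mul_ne_top measure_closedBall_lt_top.ne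
    measure_ball_lt_top.ne)
  -- The lattice has rank at most 2(m + 1), so the volumes are summable once (s + 1)2m > 2(m + 1),
  -- that is, s > 1/m.
  have hexp : 2 * ((m + 1 : ℕ) : ℝ) < (s + 1) * (2 * m) := by
    have hm' : (0 : ℝ) < m := Nat.cast_pos.2 hm
    rw [div_lt_iff₀ hm'] at hs
    push_cast
    nlinarith
  exact (summable_norm_rpow_Zxi d (m + 1) hexp).tsum_ofReal_ne_top

theorem exists_pos_of_finite_nearDirection {d n : ℕ} {M s : ℝ} {h : Fin n → ℂ}
    (hM : ‖h‖ ≤ M)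
    (hfin : {a : Fin n → Zxi d | h ∈ nearDirection M s fun i => (a i : ℂ)}.Finite) :
    ∃ c : ℝ, 0 < c ∧ ∀ a : Fin n → Zxi d, a ≠ 0 →
      ∃ i j, c * ‖fun i => (a i : ℂ)‖ ^ (-s) ≤ ‖(a i : ℂ) * h j - a j * h i‖ := by
  have hcoe : ∀ a : Fin n → Zxi d, a ≠ 0 → (fun i => (a i : ℂ)) ≠ 0 := fun a ha h0 =>
    ha (funext fun i => Subtype.ext (congrFun h0 i))
  have hne : ∀ a : Fin n → Zxi d, a ≠ 0 → ∃ i j, (a i : ℂ) * h j - a j * h i ≠ 0 := by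
    intro a ha
    by_contra! hzero
    -- If all minors of a vanished, every positive multiple of a would be exceptional, against
    -- finiteness.
    refine Set.infinite_of_injective_forall_mem (f := fun k : ℕ => (k + 1) • a) ?_ ?_ hfin
    · intro k l hkl
      obtain ⟨i, hi⟩ := Function.ne_iff.1 (hcoe a ha)
      have h1 := congrArg Subtype.val (congrFun hkl i)
      have h2 : ((k + 1 : ℕ) : ℂ) * a i = ((l + 1 : ℕ) : ℂ) * a i := by simpa using h1
      have h3 : k + 1 = l + 1 := by exact_mod_cast mul_right_cancel₀ hi h2
      omega
    · intro k
      have hk : ∀ i, (((k + 1) • a) i : ℂ) = (k + 1 : ℂ) * a i := fun i => by simp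
      refine ⟨hcoe _ (smul_ne_zero (Nat.succ_ne_zero k) ha), hM, fun i j => ?_⟩
      have h1 : (((k + 1) • a) i : ℂ) * h j - ((k + 1) • a) j * h i = 0 := by
        rw [hk, hk]
        linear_combination (k + 1 : ℂ) * hzero i j
      rw [h1, norm_zero]
      positivity
  -- A small c handles the finitely many exceptional a; any c ≤ 1 handles the rest.
  have hev : ∀ᶠ c in 𝓝[>] (0 : ℝ),
      ∀ a ∈ {a : Fin n → Zxi d | h ∈ nearDirection M s fun i => (a i : ℂ)},
        ∃ i j, c * ‖fun i => (a i : ℂ)‖ ^ (-s) ≤ ‖(a i : ℂ) * h j - a j * h i‖ := by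
    refine (Filter.eventually_all_finite hfin).2 fun a ha => ?_
    have ha0 : a ≠ 0 := by
      rintro rfl
      exact ha.1 rfl
    obtain ⟨i, j, hij⟩ := hne a ha0
    have ht : Tendsto (fun c : ℝ => c * ‖fun i => (a i : ℂ)‖ ^ (-s)) (𝓝[>] 0) (𝓝 0) := by
      refine tendsto_nhdsWithin_of_tendsto_nhds ?_
      have : Continuous fun c : ℝ => c * ‖fun i => (a i : ℂ)‖ ^ (-s) := by fun_prop
      simpa using this.tendsto 0
    filter_upwards [ht.eventually_le_const (norm_pos_iff.2 hij)] with c hc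
    exact ⟨i, j, hc⟩
  have h1 : ∀ᶠ c in 𝓝[>] (0 : ℝ), c ≤ 1 :=
    (tendsto_nhdsWithin_of_tendsto_nhds tendsto_id).eventually_le_const one_pos
  obtain ⟨c, hc, hc1, hc0⟩ := (hev.and (h1.and self_mem_nhdsWithin)).exists
  refine ⟨c, hc0, fun a ha => ?_⟩
  by_cases hmem : h ∈ nearDirection M s fun i => (a i : ℂ)
  · exact hc a hmem
  · simp only [nearDirection, Set.mem_ofPred_eq, not_and, not_forall, not_le] at hmem
    obtain ⟨i, j, hij⟩ := hmem (hcoe a ha) hM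
    exact ⟨i, j, (mul_le_of_le_one_left (by positivity) hc1).trans hij.le⟩

theorem one_le_norm_coe {d n : ℕ} {a : Fin n → Zxi d} (ha : a ≠ 0) :
    1 ≤ ‖fun i => (a i : ℂ)‖ :=
  one_le_norm_of_forall_mem_Zxi (fun i => (a i).2) fun h0 =>
    ha (funext fun i => Subtype.ext (congrFun h0 i))

/-- Almost every direction is badly approximable by vectors over `ℤ[ξ]` up to an arbitrarily small
loss in the exponent. -/
theorem ae_exists_pos_le_norm_sub (d : ℕ) {m : ℕ} (hm : 0 < m) :
    ∀ᵐ h : Fin (m + 1) → ℂ, ∀ s : ℝ, 1 / (m : ℝ) < s →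
      ∃ c : ℝ, 0 < c ∧ ∀ a : Fin (m + 1) → Zxi d, a ≠ 0 →
        ∃ i j, c * ‖fun i => (a i : ℂ)‖ ^ (-s) ≤ ‖(a i : ℂ) * h j - a j * h i‖ := by
  -- Countably many radii and exponents keep the exceptional set null; other s follow by
  -- monotonicity, as ‖a‖ ≥ 1.
  have hae : ∀ᵐ h : Fin (m + 1) → ℂ, ∀ M k : ℕ,
      {a : Fin (m + 1) → Zxi d |
        h ∈ nearDirection M (1 / (m : ℝ) + 1 / ((k : ℝ) + 1)) fun i => (a i : ℂ)}.Finite :=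
    ae_all_iff.2 fun M => ae_all_iff.2 fun k =>
      ae_finite_nearDirection d hm M (lt_add_of_pos_right _ (by positivity))
  filter_upwards [hae] with h hh s hs
  obtain ⟨M, hM⟩ := exists_nat_ge ‖h‖
  obtain ⟨k, hk⟩ := exists_nat_one_div_lt (sub_pos.2 hs)
  obtain ⟨c, hc, H⟩ := exists_pos_of_finite_nearDirection hM (hh M k)
  refine ⟨c, hc, fun a ha => ?_⟩
  obtain ⟨i, j, hij⟩ := H a ha
  refine ⟨i, j, le_trans ?_ hij⟩
  gcongr
  · exact one_le_norm_coe ha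
  · linarith

/-! ### Lower bound on the quadratic form -/

theorem le_quadForm_of_le_norm_sub {d n : ℕ} {s c : ℝ} (hs : 0 ≤ s) (hc : 0 < c) {h : Fin n → ℂ}
    (H : ∀ a : Fin n → Zxi d, a ≠ 0 →
      ∃ i j, c * ‖fun i => (a i : ℂ)‖ ^ (-s) ≤ ‖(a i : ℂ) * h j - a j * h i‖)
    {P : ℝ} (hP : 1 ≤ P) {a : Fin n → Zxi d} (ha : a ≠ 0) :
    (c / (2 * (1 + ‖h‖) ^ (1 + s))) ^ (2 / (1 + s)) * P ^ (-(s / (1 + s))) ≤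
      quadForm h (fun i => (a i : ℂ)) P := by
  have hP0 : 0 < P := by linarith
  set F := quadForm h (fun i => (a i : ℂ)) P
  have hF : 0 ≤ F := quadForm_nonneg h _ hP0
  obtain ⟨h1, h2⟩ := norm_le_of_quadForm h (fun i => (a i : ℂ)) hP
  obtain ⟨i, j, hij⟩ := H a ha
  have hA : 0 < ‖fun i => (a i : ℂ)‖ := one_pos.trans_le (one_le_norm_coe ha)
  set A := ‖fun i => (a i : ℂ)‖
  set X := Real.sqrt F
  have hX0 : 0 < X := by
    refine (Real.sqrt_nonneg F).lt_of_ne fun h0 => ?_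
    rw [show X = 0 from h0.symm, zero_mul, zero_mul] at h1
    linarith
  have hB : 0 < 1 + ‖h‖ := by positivity
  set K := 2 * (1 + ‖h‖) ^ (1 + s)
  have hK : 0 < K := by positivity
  have hsP : Real.sqrt P ^ s = P ^ (s / 2) := by
    rw [Real.sqrt_eq_rpow, ← Real.rpow_mul hP0.le]
    congr 1
    ring
  -- Multiply the minor bound c A^(-s) ≤ 2‖h‖ X by A^s, using A ≤ X √P (1 + ‖h‖).
  have h3 : c ≤ K * (X ^ (1 + s) * P ^ (s / 2)) := by
    calc c = c * A ^ (-s) * A ^ s := by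
          rw [mul_assoc, ← Real.rpow_add hA]; simp
      _ ≤ X * (2 * ‖h‖) * (X * Real.sqrt P * (1 + ‖h‖)) ^ s := by
          exact mul_le_mul (hij.trans (h2 i j)) (by gcongr) (by positivity) (by positivity)
      _ ≤ X * (2 * (1 + ‖h‖)) * (X * Real.sqrt P * (1 + ‖h‖)) ^ s := by
          gcongr
          linarith
      _ = K * (X ^ (1 + s) * P ^ (s / 2)) := by
          rw [Real.mul_rpow (by positivity) hB.le, Real.mul_rpow hX0.le (Real.sqrt_nonneg _), hsP,
            Real.rpow_add hX0, Real.rpow_one]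
          simp only [K]
          rw [Real.rpow_add hB, Real.rpow_one]
          ring
  have h4 : c / K * P ^ (-(s / 2)) ≤ X ^ (1 + s) := by
    rw [Real.rpow_neg hP0.le, ← div_eq_mul_inv, div_div, div_le_iff₀ (by positivity)]
    linarith
  have h5 := Real.rpow_le_rpow (z := 2 / (1 + s)) (by positivity) h4 (by positivity)
  have h6 : (X ^ (1 + s)) ^ (2 / (1 + s)) = F := by
    rw [← Real.rpow_mul hX0.le, mul_div_cancel₀ _ (by positivity : (1 + s) ≠ 0), Real.rpow_two,
      Real.sq_sqrt hF]
  have h7 : (P ^ (-(s / 2))) ^ (2 / (1 + s)) = P ^ (-(s / (1 + s))) := by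
    rw [← Real.rpow_mul hP0.le]
    congr 1
    field_simp
  rwa [Real.mul_rpow (by positivity) (by positivity), h6, h7] at h5

theorem ae_exists_pos_le_quadForm (d n : ℕ) [NeZero n] :
    ∀ᵐ h : Fin n → ℂ, ∀ ε : ℝ, 0 < ε → ∃ c : ℝ, 0 < c ∧ ∀ P : ℝ, 1 ≤ P →
      ∀ a : Fin n → Zxi d, a ≠ 0 →
        c * P ^ (-(1 / (n : ℝ) + ε)) ≤ quadForm h (fun i => (a i : ℂ)) P := by
  obtain ⟨m, rfl⟩ : ∃ m, n = m + 1 := Nat.exists_eq_succ_of_ne_zero (NeZero.ne n)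
  -- For n = 1 the minors carry no information, but 1 ≤ ‖a‖ ≤ √(FP)(1 + ‖h‖) already gives F ≳ 1/P.
  rcases Nat.eq_zero_or_pos m with rfl | hm
  · refine Eventually.of_forall fun h ε hε => ⟨((1 + ‖h‖) ^ 2)⁻¹, by positivity, ?_⟩
    intro P hP a ha
    have hP0 : 0 < P := by linarith
    have h1 := (one_le_norm_coe ha).trans (norm_le_of_quadForm h (fun i => (a i : ℂ)) hP).1
    have hF := quadForm_nonneg h (fun i => (a i : ℂ)) hP0
    have h2 : 1 ≤ quadForm h (fun i => (a i : ℂ)) P * P * (1 + ‖h‖) ^ 2 := by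
      have h3 := one_le_pow₀ (n := 2) h1
      rwa [mul_pow, mul_pow, Real.sq_sqrt hF, Real.sq_sqrt hP0.le] at h3
    calc ((1 + ‖h‖) ^ 2)⁻¹ * P ^ (-(1 / ((0 + 1 : ℕ) : ℝ) + ε))
        ≤ ((1 + ‖h‖) ^ 2)⁻¹ * P ^ (-1 : ℝ) := by
          refine mul_le_mul_of_nonneg_left (Real.rpow_le_rpow_of_exponent_le hP ?_) (by positivity)
          simp [hε.le]
      _ ≤ _ := by
          rw [Real.rpow_neg_one, ← mul_inv, inv_le_iff_one_le_mul₀ (by positivity)]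
          linarith
  · filter_upwards [ae_exists_pos_le_norm_sub d hm] with h hh ε hε
    have hm' : (0 : ℝ) < m := Nat.cast_pos.2 hm
    have hs : 0 < 1 / (m : ℝ) + ε := by positivity
    obtain ⟨c, hc, H⟩ := hh (1 / (m : ℝ) + ε) (lt_add_of_pos_right _ hε)
    -- At ε = 0 this is the equality s/(1+s) = 1/(m+1) for s = 1/m.
    have hexp : (1 / (m : ℝ) + ε) / (1 + (1 / (m : ℝ) + ε)) ≤ 1 / ((m + 1 : ℕ) : ℝ) + ε := by
      rw [div_le_iff₀ (by positivity)]
      push_cast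
      have h1 : 1 / ((m : ℝ) + 1) * (1 + 1 / m) = 1 / m := by field_simp
      have h2 : 0 ≤ 1 / ((m : ℝ) + 1) * ε := by positivity
      have h3 : 0 ≤ ε * (1 / (m : ℝ) + ε) := by positivity
      linarith
    refine ⟨(c / (2 * (1 + ‖h‖) ^ (1 + (1 / (m : ℝ) + ε)))) ^ (2 / (1 + (1 / (m : ℝ) + ε))),
      by positivity, fun P hP a ha => ?_⟩
    refine le_trans ?_ (le_quadForm_of_le_norm_sub hs.le hc H hP ha)
    exact mul_le_mul_of_nonneg_left
      (Real.rpow_le_rpow_of_exponent_le hP (neg_le_neg hexp)) (by positivity)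

/-! ### Degrees of freedom -/

theorem tendsto_div_of_forall_abs_sub_le {f L : ℝ → ℝ} {x : ℝ} (hL : Tendsto L atTop atTop)
    (H : ∀ ε : ℝ, 0 < ε → ∃ C : ℝ, ∀ᶠ P in atTop, |f P - x * L P| ≤ ε * L P + C) :
    Tendsto (fun P => f P / L P) atTop (𝓝 x) := by
  rw [Metric.tendsto_nhds]
  intro ε hε
  obtain ⟨C, hC⟩ := H (ε / 2) (half_pos hε)
  filter_upwards [hC, hL.eventually_gt_atTop 0, hL.eventually_gt_atTop (C / (ε / 2))]
    with P h1 h2 h3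
  rw [div_lt_iff₀ (half_pos hε)] at h3
  rw [Real.dist_eq, div_sub' h2.ne', abs_div, abs_of_pos h2, div_lt_iff₀ h2, mul_comm (L P)]
  linarith

theorem hasDoF_of_isALLLCoeff {d : ℕ} (hd : 0 < d) {δ : ℝ} (hδ : coveringRadius d ^ 2 < δ)
    (hδ1 : δ ≤ 1) {n : ℕ} [NeZero n] {h : Fin n → ℂ} (hh : h ≠ 0)
    (hlow : ∀ ε : ℝ, 0 < ε → ∃ c : ℝ, 0 < c ∧ ∀ P : ℝ, 1 ≤ P →
      ∀ a : Fin n → Zxi d, a ≠ 0 →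
        c * P ^ (-(1 / (n : ℝ) + ε)) ≤ quadForm h (fun i => (a i : ℂ)) P)
    {a : ℝ → Fin n → Zxi d} (ha : ∀ P : ℝ, 0 < P → IsALLLCoeff d δ h P (a P)) :
    HasDoF h (fun P i => (a P i : ℂ)) (1 / (n : ℝ)) := by
  have hn : (0 : ℝ) < n := Nat.cast_pos.2 (NeZero.pos n)
  have hL : Tendsto (fun P : ℝ => Real.log (1 + P)) atTop atTop :=
    Real.tendsto_log_atTop.comp (tendsto_atTop_add_const_left _ _ tendsto_id)
  have hH : 0 < ∑ i, ‖h i‖ ^ 2 := by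
    obtain ⟨i, hi⟩ := Function.ne_iff.1 hh
    exact Finset.sum_pos' (fun i _ => by positivity)
      ⟨i, Finset.mem_univ i, pow_pos (norm_pos_iff.2 hi) 2⟩
  set S := ∑ i, ‖h i‖ ^ 2
  set β := δ - coveringRadius d ^ 2
  have hβ : 0 < β := sub_pos.2 hδ
  refine tendsto_div_of_forall_abs_sub_le hL fun ε hε => ?_
  obtain ⟨c, hc, hcF⟩ := hlow ε hε
  refine ⟨|Real.log c| + (|Real.log (β ^ n)| + |Real.log (min 1 S)| / n), ?_⟩
  filter_upwards [eventually_ge_atTop 1] with P hP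
  have hP0 : 0 < P := by linarith
  have hlowP := hcF P hP (a P) (ha P hP0).ne_zero
  have hup := (ha P hP0).quadForm_le hd hδ.le hδ1 hP0.le
  change |Real.posLog (1 / quadForm h (fun i => (a P i : ℂ)) P) - _| ≤ _
  set F := quadForm h (fun i => (a P i : ℂ)) P
  have hF : 0 < F := lt_of_lt_of_le (by positivity) hlowP
  have hlog : Real.log (1 / F) = -Real.log F := by rw [one_div, Real.log_inv]
  have hlogP : Real.log P ≤ Real.log (1 + P) := Real.log_le_log hP0 (by linarith)
  have hlogP0 : 0 ≤ Real.log (1 + P) := Real.log_nonneg (by linarith)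
  have h1 : -Real.log F ≤ (1 / n + ε) * Real.log (1 + P) + |Real.log c| := by
    have h2 := Real.log_le_log (by positivity) hlowP
    rw [Real.log_mul hc.ne' (by positivity), Real.log_rpow hP0] at h2
    have h3 : (1 / n + ε) * Real.log P ≤ (1 / n + ε) * Real.log (1 + P) := by gcongr
    linarith [neg_abs_le (Real.log c)]
  have h4 : 1 / n * Real.log (1 + P) - (|Real.log (β ^ n)| + |Real.log (min 1 S)| / n) ≤
      -Real.log F := by
    have hmin : 0 < min 1 S := lt_min one_pos hH
    -- Trades the determinant for log(1 + P) at the cost of a constant independent of P.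
    have h5 : min 1 S * (1 + P) ≤ 1 + P * S := by
      nlinarith [min_le_left 1 S, min_le_right 1 S]
    have h6 := Real.log_le_log (by positivity) h5
    have h7 := Real.log_nonpos (by positivity) hup
    rw [Real.log_mul (by positivity) (by positivity), Real.log_pow,
      Real.log_mul (by positivity) hF.ne'] at h7
    rw [Real.log_mul hmin.ne' (by positivity)] at h6
    have h8 : n * (1 / n * Real.log (1 + P) - (|Real.log (β ^ n)| + |Real.log (min 1 S)| / n)) ≤
        n * -Real.log F := by
      have h9 : n * (1 / n * Real.log (1 + P) - (|Real.log (β ^ n)| + |Real.log (min 1 S)| / n)) =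
          Real.log (1 + P) - n * |Real.log (β ^ n)| - |Real.log (min 1 S)| := by
        field_simp
        ring
      have h10 : n * -|Real.log (β ^ n)| ≤ n * Real.log (β ^ n) := by
        gcongr
        exact neg_abs_le _
      linarith [neg_abs_le (Real.log (min 1 S))]
    exact le_of_mul_le_mul_left h8 hn
  rw [Real.posLog, hlog, abs_le]
  have h11 : 0 ≤ ε * Real.log (1 + P) := by positivity
  have h12 : 0 ≤ 1 / n * Real.log (1 + P) := by positivity
  have h13 : 0 ≤ |Real.log (β ^ n)| + |Real.log (min 1 S)| / n := by positivity
  have h14 := abs_nonneg (Real.log c)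
  have h15 := le_max_right 0 (-Real.log F)
  constructor
  · linarith
  -- The truncation in log⁺ is harmless because the upper bound is itself nonnegative.
  · have h16 : max 0 (-Real.log F) ≤ (1 / n + ε) * Real.log (1 + P) + |Real.log c| :=
      max_le (by positivity) h1
    linarith

end AlgLLL

theorem mainTheorem4 (d : ℕ) (hd : Squarefree d) (δ : ℝ)
    (hδ : AlgLLL.coveringRadius d ^ 2 < δ) (hδ1 : δ ≤ 1) (n : ℕ) [NeZero n] :
    ∀ᵐ h : Fin n → ℂ,
      (∀ P : ℝ, 0 < P → ∃ a : Fin n → AlgLLL.Zxi d, AlgLLL.IsALLLCoeff d δ h P a) ∧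
      ∀ a : ℝ → Fin n → AlgLLL.Zxi d,
        (∀ P : ℝ, 0 < P → AlgLLL.IsALLLCoeff d δ h P (a P)) →
        AlgLLL.HasDoF h (fun P i => (a P i : ℂ)) (1 / (n : ℝ)) := by
  have hne : ∀ᵐ h : Fin n → ℂ, h ≠ 0 := by simp [ae_iff]
  filter_upwards [hne, AlgLLL.ae_exists_pos_le_quadForm d n] with h hh hlow
  exact ⟨fun P hP => AlgLLL.exists_isALLLCoeff d hδ1 h hP, fun a ha =>
    AlgLLL.hasDoF_of_isALLLCoeff (Nat.pos_of_ne_zero hd.ne_zero) hδ hδ1 hh hlow ha⟩
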